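/- Let $n\ge 1$ be an integer and let $a=(a_k)_{k\ge0}$, $b=(b_k)_{k\ge0}$, $c=(c_k)_{k\ge0}$ be $(n+1)$-periodic sequences of complex numbers (that is, $a_{k+n+1}=a_k$ for all $k$, and likewise for $b$ and $c$). Let $T=T(a,b,c)$ be the bounded tridiagonal operator on $\ell^2(\mathbb N_0)$ given by $$(Tf)_0=b_0f_0+c_0f_1,\qquad (Tf)_k=a_kf_{k-1}+b_kf_k+c_kf_{k+1}\quad(k\ge1),$$ and let $W(T)=\{\langle Tf,f\rangle:\|f\|=1\}$ be its numerical range. For $0\le j<n$ put $$\alpha_j=\frac{c_j+\overline{a_{j+1}}}{2},\quad \gamma_j=\frac{c_j-\overline{a_{j+1}}}{2i},\qquad\text{and}\qquad \alpha_n=\frac{a_0+\overline{c_n}}{2},\quad \gamma_n=\frac{a_0-\overline{c_n}}{2i}.$$ For real $t,x,y$ let $\Lambda=(\lambda_{i,j})_{1\le i,j\le n+1}$ be the tridiagonal matrix with $$\lambda_{j,j}=t+\operatorname{Re}(b_{j-1})x+\operatorname{Im}(b_{j-1})y\quad(1\le j\le n+1),$$ $$\lambda_{j,j+1}=\alpha_{j-1}x+\gamma_{j-1}y,\qquad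 \lambda_{j+1,j}=\overline{\alpha_{j-1}}x+\overline{\gamma_{j-1}}y\quad(1\le j\le n),$$ and all other entries $0$. Let $G_n(t,x,y)=\det\Lambda$, and let $H_n(t,x,y)=\det(\lambda_{i,j})_{2\le i,j\le n}$, with $H_1=1$. Define $$P(t,x,y)=\bigl(G_n(t,x,y)-|\alpha_nx+\gamma_ny|^2H_n(t,x,y)\bigr)^2-4\prod_{j=0}^{n}|\alpha_jx+\gamma_jy|^2 .$$ Then $P$ is a homogeneous polynomial of degree $2(n+1)$ in $(t,x,y)$ with real coefficients, $P(t,0,0)=t^{2(n+1)}$ for all $t\in\mathbb R$, and for every $\theta\in\mathbb R$ the polynomial $P(t,-\cos\theta,-\sin\theta)$ in $t$ has a largest real root and $$\sup\{\operatorname{Re}(e^{-i\theta}z):z\in W(T)\}=\max\{t\in\mathbb R:P(t,-\cos\theta,-\sin\theta)=0\}.$$ -/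

import Mathlib

open scoped ComplexConjugate

namespace PeriodicTridiagonal

noncomputable section

/-- The Hilbert space `ℓ²(ℕ₀)` of complex sequences. -/
abbrev EllTwo : Type := lp (fun _ : ℕ => ℂ) 2

/-- The numerical range `W(A) = {⟨A x, x⟩ : ‖x‖ = 1}`. Mathlib's inner product is linear in its
second argument. -/
def numericalRange {E : Type*} [NormedAddCommGroup E] [InnerProductSpace ℂ E] (A : E →L[ℂ] E) :
    Set ℂ :=
  {z | ∃ x : E, ‖x‖ = 1 ∧ inner ℂ x (A x) = z}

/-- The action of the tridiagonal matrix with rows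
`(…, 0, a_k, b_k, c_k, 0, …)`, where `b_k` is on the diagonal, on a sequence. -/
def tridiagAction (a b c : ℕ → ℂ) (f : ℕ → ℂ) (k : ℕ) : ℂ :=
  (if k = 0 then 0 else a k * f (k - 1)) + b k * f k + c k * f (k + 1)

lemma exists_bound_of_periodic {n : ℕ} {a : ℕ → ℂ} (ha : Function.Periodic a (n + 1)) :
    ∃ C : ℝ, ∀ k, ‖a k‖ ≤ C := by
  refine ⟨∑ i ∈ Finset.range (n + 1), ‖a i‖, fun k => ?_⟩
  rw [← ha.map_mod_nat k]
  exact Finset.single_le_sum (f := fun i => ‖a i‖) (fun i _ => norm_nonneg _)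
    (Finset.mem_range.2 (Nat.mod_lt _ n.succ_pos))

lemma memℓp_two_iff (f : ℕ → ℂ) : Memℓp f 2 ↔ Summable fun k => ‖f k‖ ^ 2 := by
  rw [memℓp_gen_iff (by norm_num)]
  simp

lemma memℓp_mul {n : ℕ} {a : ℕ → ℂ} (ha : Function.Periodic a (n + 1)) {f : ℕ → ℂ}
    (hf : Memℓp f 2) : Memℓp (fun k => a k * f k) 2 := by
  obtain ⟨C, hC⟩ := exists_bound_of_periodic ha
  rw [memℓp_two_iff] at hf ⊢
  refine Summable.of_nonneg_of_le (fun k => by positivity) (fun k => ?_) (hf.mul_left (C ^ 2))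
  rw [norm_mul, mul_pow]
  have := hC k
  gcongr

lemma memℓp_tridiagAction {n : ℕ} {a b c : ℕ → ℂ} (ha : Function.Periodic a (n + 1))
    (hb : Function.Periodic b (n + 1)) (hc : Function.Periodic c (n + 1)) {f : ℕ → ℂ}
    (hf : Memℓp f 2) : Memℓp (tridiagAction a b c f) 2 := by
  have h1 : Memℓp (fun k : ℕ => if k = 0 then (0 : ℂ) else f (k - 1)) 2 := by
    rw [memℓp_two_iff] at hf ⊢
    rw [← summable_nat_add_iff 1]
    simpa using hf
  have h2 : Memℓp (fun k : ℕ => f (k + 1)) 2 := by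
    rw [memℓp_two_iff] at hf ⊢
    exact (summable_nat_add_iff 1).2 hf
  have h := ((memℓp_mul ha h1).add (memℓp_mul hb hf)).add (memℓp_mul hc h2)
  convert h using 1
  funext k
  simp [tridiagAction]

/-- The action of the tridiagonal matrix as a linear map of `ℓ²(ℕ₀)`. -/
def tridiagLinear {n : ℕ} {a b c : ℕ → ℂ} (ha : Function.Periodic a (n + 1))
    (hb : Function.Periodic b (n + 1)) (hc : Function.Periodic c (n + 1)) :
    EllTwo →ₗ[ℂ] EllTwo where
  toFun f := ⟨tridiagAction a b c f, memℓp_tridiagAction ha hb hc f.2⟩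
  map_add' f g := by
    ext k
    simp only [tridiagAction, lp.coeFn_add, Pi.add_apply]
    split_ifs <;> ring
  map_smul' r f := by
    ext k
    simp only [tridiagAction, lp.coeFn_smul, Pi.smul_apply, smul_eq_mul, RingHom.id_apply]
    split_ifs <;> ring

/-- The `(n+1)`-periodic tridiagonal operator `T(a, b, c)`, as a bounded operator on `ℓ²(ℕ₀)`. -/
def tridiagOp {n : ℕ} {a b c : ℕ → ℂ} (ha : Function.Periodic a (n + 1))
    (hb : Function.Periodic b (n + 1)) (hc : Function.Periodic c (n + 1)) :
    EllTwo →L[ℂ] EllTwo where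
  toLinearMap := tridiagLinear ha hb hc
  cont := by
    refine (tridiagLinear ha hb hc).continuous_of_seq_closed_graph fun u x y hu hTu => ?_
    have hev : ∀ k : ℕ, Continuous fun f : EllTwo => f k := fun k =>
      (lp.evalCLM ℂ (fun _ : ℕ => ℂ) 2 k).continuous
    ext k
    have h1 := ((hev k).tendsto y).comp hTu
    have h2 : Continuous fun f : EllTwo => tridiagLinear ha hb hc f k := by
      change Continuous fun f : EllTwo =>
        (if k = 0 then 0 else a k * f (k - 1)) + b k * f k + c k * f (k + 1)
      refine Continuous.add (Continuous.add ?_ ((hev k).const_mul (b k)))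
        ((hev (k + 1)).const_mul (c k))
      split_ifs
      · exact continuous_const
      · exact (hev (k - 1)).const_mul (a k)
    exact tendsto_nhds_unique h1 ((h2.tendsto x).comp hu)

lemma tridiagOp_apply {n : ℕ} {a b c : ℕ → ℂ} (ha : Function.Periodic a (n + 1))
    (hb : Function.Periodic b (n + 1)) (hc : Function.Periodic c (n + 1)) (f : EllTwo) (k : ℕ) :
    tridiagOp ha hb hc f k =
      (if k = 0 then 0 else a k * f (k - 1)) + b k * f k + c k * f (k + 1) := rfl

/-- The numbers `α_j`, `0 ≤ j ≤ n`. -/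
def alpha (n : ℕ) (a c : ℕ → ℂ) (j : ℕ) : ℂ :=
  if j < n then (c j + conj (a (j + 1))) / 2 else (a 0 + conj (c n)) / 2

/-- The numbers `γ_j`, `0 ≤ j ≤ n`. -/
def gamma (n : ℕ) (a c : ℕ → ℂ) (j : ℕ) : ℂ :=
  if j < n then (c j - conj (a (j + 1))) / (2 * Complex.I)
  else (a 0 - conj (c n)) / (2 * Complex.I)

/-- The entries of the tridiagonal matrices, with rows and columns numbered from `0`. -/
def entry (n : ℕ) (a b c : ℕ → ℂ) (t x y : ℝ) (i j : ℕ) : ℂ :=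
  if j = i then ((t + (b i).re * x + (b i).im * y : ℝ) : ℂ)
  else if j = i + 1 then alpha n a c i * x + gamma n a c i * y
  else if i = j + 1 then conj (alpha n a c j) * x + conj (gamma n a c j) * y
  else 0

/-- `G_n(t, x, y)`: the determinant of the full `(n+1) × (n+1)` tridiagonal matrix. -/
def G (n : ℕ) (a b c : ℕ → ℂ) (t x y : ℝ) : ℂ :=
  (Matrix.of fun i j : Fin (n + 1) => entry n a b c t x y i j).det

/-- `H_n(t, x, y)`: the determinant of the `(n-1) × (n-1)` tridiagonal matrix obtained by removing
the first and last rows and columns; it is `1` for `n = 1`. -/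
def H (n : ℕ) (a b c : ℕ → ℂ) (t x y : ℝ) : ℂ :=
  (Matrix.of fun i j : Fin (n - 1) => entry n a b c t x y (i + 1) (j + 1)).det

/-- `P(t, x, y)`, as the complex number that the defining formula gives. -/
def P (n : ℕ) (a b c : ℕ → ℂ) (t x y : ℝ) : ℂ :=
  (G n a b c t x y
      - ((‖alpha n a c n * x + gamma n a c n * y‖ ^ 2 : ℝ) : ℂ) * H n a b c t x y) ^ 2
    - 4 * ∏ j ∈ Finset.range (n + 1), ((‖alpha n a c j * x + gamma n a c j * y‖ ^ 2 : ℝ) : ℂ)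

end

end PeriodicTridiagonal

/-! Put `ω = exp (-iθ)`. The real part of `ω T` is a periodic Jacobi operator with diagonal `β k =
Re (ω b k)` and off-diagonal entries `w k = hopping ω a c k`. The phases of `w` can be removed by a
unitary diagonal matrix, since the graph of the operator is a path. So only `v k = ‖w k‖` matters,
and the supremum sought is the largest eigenvalue `l` of one period closed into a cycle with
couplings `v`.

Upper bound (`tsum_periodic_form_le`): replace each residue class of `|f|` modulo `n + 1` by its ℓ²
norm. By Cauchy–Schwarz and `v ≥ 0`, the form of `f` is at most the cyclic form of these norms.
Lower bound (`exists_re_mul_inner_tridiagOp_ge`): repeat a maximizer of the cyclic form over `M`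
periods, with gauge phases. Cutting it off costs a constant, negligible against `M`.

Algebra: let `D` be the determinant of `t` minus the cyclic matrix and `Π = ∏ v j`. Expanding along
the corners (`det_cyclicMatrix`) gives `D = G - v_n² H - 2Π` at `(t, -cos θ, -sin θ)`, hence `P = (D
+ 2Π)² - 4Π² = D (D + 4Π)`. At `t = l` the factor `D` vanishes; for `t > l` it is positive, and so
is `D + 4Π`. Thus `l` is the largest real root. -/

namespace PeriodicTridiagonal

open Matrix Finset

/-! ### Determinants of tridiagonal matrices with corners -/

/-- The tridiagonal matrix with diagonal `d`, superdiagonal `p` and subdiagonal `q`. -/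
def tridiag {R : Type*} [Zero R] (d p q : ℕ → R) (m : ℕ) : Matrix (Fin m) (Fin m) R :=
  Matrix.of fun i j =>
    if (j : ℕ) = i then d i else if (j : ℕ) = i + 1 then p i else if (i : ℕ) = j + 1 then q j else 0

/-- Deleting the first row and the last column moves the subdiagonal onto the diagonal, with zeros
below it. -/
lemma det_submatrix_succ_castSucc_tridiag {R : Type*} [CommRing R] (d p q : ℕ → R) (m : ℕ) :
    ((tridiag d p q (m + 1)).submatrix Fin.succ Fin.castSucc).det = ∏ j ∈ range m, q j := by
  rw [Matrix.det_of_isUpperTriangular, ← Fin.prod_univ_eq_prod_range]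
  · refine Finset.prod_congr rfl fun i _ => ?_
    have : ¬ (i : ℕ) = i + 1 + 1 := by omega
    simp [tridiag, this]
  · intro i j hij
    have hij : (j : ℕ) < i := hij
    simp only [tridiag, Matrix.submatrix_apply, Matrix.of_apply, Fin.val_succ, Fin.val_castSucc]
    rw [if_neg (by omega), if_neg (by omega), if_neg (by omega)]

lemma tridiag_transpose {R : Type*} [CommRing R] (d p q : ℕ → R) (m : ℕ) :
    (tridiag d p q m)ᵀ = tridiag d q p m := by
  ext i j
  simp only [tridiag, Matrix.transpose_apply, Matrix.of_apply]
  split_ifs <;> first | omega | simp_all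

lemma det_submatrix_castSucc_succ_tridiag {R : Type*} [CommRing R] (d p q : ℕ → R) (m : ℕ) :
    ((tridiag d p q (m + 1)).submatrix Fin.castSucc Fin.succ).det = ∏ j ∈ range m, p j := by
  rw [← det_submatrix_succ_castSucc_tridiag d q p, ← tridiag_transpose d p q, ← det_transpose,
    Matrix.transpose_submatrix]

/-- The determinant of a tridiagonal matrix with two additional corner entries. -/
lemma det_tridiag_updateRow_corners {R : Type*} [CommRing R] (d p q : ℕ → R) (m : ℕ) (x y : R) :
    (((tridiag d p q (m + 2)).updateRow 0
        (tridiag d p q (m + 2) 0 + x • Pi.single (Fin.last (m + 1)) 1)).updateRow (Fin.last (m + 1))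
        (tridiag d p q (m + 2) (Fin.last (m + 1)) + y • Pi.single 0 1)).det =
      (tridiag d p q (m + 2)).det
        - x * y * (tridiag (fun k => d (k + 1)) (fun k => p (k + 1)) (fun k => q (k + 1)) m).det
        + (-1) ^ (m + 1) * (x * ∏ j ∈ range (m + 1), q j + y * ∏ j ∈ range (m + 1), p j) := by
  set A := tridiag d p q (m + 2) with hA
  have hne : (0 : Fin (m + 2)) ≠ Fin.last (m + 1) := by
    simp [Fin.ext_iff]
  have h1 : (A.updateRow 0 (Pi.single (Fin.last (m + 1)) 1)).det =
      (-1) ^ (m + 1) * ∏ j ∈ range (m + 1), q j := by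
    rw [← adjugate_apply, adjugate_fin_succ_eq_det_submatrix, Fin.succAbove_last,
      Fin.succAbove_zero, hA, det_submatrix_succ_castSucc_tridiag]
    simp
  have h2 : (A.updateRow (Fin.last (m + 1)) (Pi.single 0 1)).det =
      (-1) ^ (m + 1) * ∏ j ∈ range (m + 1), p j := by
    rw [← adjugate_apply, adjugate_fin_succ_eq_det_submatrix, Fin.succAbove_last,
      Fin.succAbove_zero, hA, det_submatrix_castSucc_succ_tridiag]
    simp
  have h3 : ((A.updateRow 0 (Pi.single (Fin.last (m + 1)) 1)).updateRow
      (Fin.last (m + 1)) (Pi.single 0 1)).det =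
      -(tridiag (fun k => d (k + 1)) (fun k => p (k + 1)) (fun k => q (k + 1)) m).det := by
    rw [← adjugate_apply, adjugate_fin_succ_eq_det_submatrix, Fin.succAbove_last,
      Fin.succAbove_zero, det_succ_row_zero, Finset.sum_eq_single (Fin.last m)]
    · have : ((A.updateRow 0 (Pi.single (Fin.last (m + 1)) 1)).submatrix Fin.castSucc
          Fin.succ).submatrix Fin.succ (Fin.last m).succAbove =
          tridiag (fun k => d (k + 1)) (fun k => p (k + 1)) (fun k => q (k + 1)) m := by
        ext i j
        simp [hA, tridiag]
      rw [this]
      -- The two cofactor signs `(-1) ^ (m + 1)` and `(-1) ^ m` multiply to `-1`.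
      simp [← mul_assoc, ← pow_add]
    · intro j _ hj
      have : j.succ ≠ Fin.last (m + 1) := by
        intro h; exact hj (Fin.succ_injective _ (by simpa using h))
      simp [this]
    · simp
  have e1 : (A.updateRow 0 (A 0 + x • Pi.single (Fin.last (m + 1)) 1)).det =
      A.det + x * (A.updateRow 0 (Pi.single (Fin.last (m + 1)) 1)).det := by
    rw [det_updateRow_add, det_updateRow_smul, updateRow_eq_self]
  rw [det_updateRow_add, det_updateRow_smul]
  have e2 : (A.updateRow 0 (A 0 + x • Pi.single (Fin.last (m + 1)) 1)).updateRow (Fin.last (m + 1))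
      (A (Fin.last (m + 1))) = A.updateRow 0 (A 0 + x • Pi.single (Fin.last (m + 1)) 1) := by
    conv_rhs => rw [← updateRow_eq_self (A.updateRow 0 (A 0 + x • Pi.single (Fin.last (m + 1)) 1))
      (Fin.last (m + 1))]
    rw [updateRow_ne hne.symm]
  rw [e2, e1, updateRow_comm _ hne, det_updateRow_add, det_updateRow_smul,
    updateRow_comm _ hne.symm, h1]
  have e3 : (A.updateRow (Fin.last (m + 1)) (Pi.single 0 1)).updateRow 0 (A 0) =
      A.updateRow (Fin.last (m + 1)) (Pi.single 0 1) := by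
    conv_rhs => rw [← updateRow_eq_self (A.updateRow (Fin.last (m + 1)) (Pi.single 0 1)) 0]
    rw [updateRow_ne hne]
  rw [updateRow_comm _ hne, e3, updateRow_comm _ hne.symm, h2, h3]
  ring

/-- Conjugating a tridiagonal matrix by a unitary diagonal matrix does not change its
determinant. -/
lemma det_tridiag_gauge (d p : ℕ → ℂ) (e : ℕ → ℂ) (he : ∀ k, ‖e k‖ = 1) (r : ℕ → ℂ)
    (hr : ∀ k, conj (r k) = r k) (h : ∀ k, conj (e k) * p k * e (k + 1) = r k) (m : ℕ) :
    (tridiag d p (fun k => conj (p k)) m).det = (tridiag d r r m).det := by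
  have he' : ∀ k, conj (e k) * e k = 1 := fun k => by
    rw [Complex.conj_mul', he]; simp
  have key : tridiag d r r m = Matrix.of fun i j : Fin m => e j *
      (Matrix.of fun i j : Fin m => conj (e i) * tridiag d p (fun k => conj (p k)) m i j) i j := by
    ext i j
    simp only [tridiag, Matrix.of_apply]
    split_ifs with h1 h2 h3
    · rw [h1]; linear_combination (-(d i)) * he' i
    · rw [h2, ← h]; ring
    · rw [h3, ← hr, ← h]; simp; ring
    · simp
  rw [key, det_mul_row (fun i : Fin m => e i), det_mul_column (fun i : Fin m => conj (e i)),
    ← mul_assoc, ← Finset.prod_mul_distrib]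
  simp [mul_comm (e _), he']

/-! ### The cyclic form of one period and its matrix -/

/-- The cyclic quadratic form with diagonal coefficients `β` and coupling coefficients `v`. -/
def cyclicForm (n : ℕ) (β v : ℕ → ℝ) (g : Fin (n + 1) → ℝ) : ℝ :=
  ∑ i : Fin (n + 1), (β i * g i ^ 2 + 2 * (v i * (g i * g (i + 1))))

/-- The symmetric matrix of `t ‖g‖² - cyclicForm n β v g`. -/
def cyclicMatrix (n : ℕ) (β v : ℕ → ℝ) (t : ℝ) : Matrix (Fin (n + 1)) (Fin (n + 1)) ℝ :=
  Matrix.of fun i j => (if j = i then t - β i else 0) - (if j = i + 1 then v i else 0)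
    - (if i = j + 1 then v j else 0)

lemma dotProduct_cyclicMatrix_mulVec (n : ℕ) (β v : ℕ → ℝ) (t : ℝ) (g : Fin (n + 1) → ℝ) :
    g ⬝ᵥ (cyclicMatrix n β v t *ᵥ g) = t * ∑ i, g i ^ 2 - cyclicForm n β v g := by
  have h : ∑ i : Fin (n + 1), ∑ j : Fin (n + 1), (if i = j + 1 then v j else 0) * g j * g i =
      ∑ i : Fin (n + 1), v i * (g i * g (i + 1)) := by
    rw [Finset.sum_comm]
    refine Finset.sum_congr rfl fun j _ => ?_
    simp [ite_mul, mul_assoc]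
  have h' : g ⬝ᵥ (cyclicMatrix n β v t *ᵥ g) = ∑ i : Fin (n + 1), ((t - β i) * g i ^ 2
      - v i * (g i * g (i + 1)) - ∑ j : Fin (n + 1), (if i = j + 1 then v j else 0) * g j * g i) := by
    refine Finset.sum_congr rfl fun i _ => ?_
    simp only [mulVec, dotProduct, cyclicMatrix, Matrix.of_apply, sub_mul, Finset.sum_sub_distrib,
      mul_sub, Finset.mul_sum, ite_mul, zero_mul, mul_ite, mul_zero, Finset.sum_ite_eq',
      Finset.mem_univ, if_true]
    congr 1
    · ring
    · exact Finset.sum_congr rfl fun j _ => by split_ifs <;> ring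
  rw [h', Finset.sum_sub_distrib, h, cyclicForm, Finset.mul_sum, ← Finset.sum_sub_distrib,
    ← Finset.sum_sub_distrib]
  exact Finset.sum_congr rfl fun i _ => by ring

lemma isHermitian_cyclicMatrix (n : ℕ) (β v : ℕ → ℝ) (t : ℝ) :
    (cyclicMatrix n β v t).IsHermitian := by
  ext i j
  simp only [cyclicMatrix, conjTranspose_apply, Matrix.of_apply, star_trivial]
  by_cases h : i = j
  · subst h; simp
  · rw [if_neg h, if_neg (Ne.symm h)]; ring

/-- The cyclic form attains its largest Rayleigh quotient. -/
lemma exists_max_cyclicForm (n : ℕ) (β v : ℕ → ℝ) :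
    ∃ (l : ℝ) (u : Fin (n + 1) → ℝ), 0 < ∑ i, u i ^ 2 ∧
      cyclicForm n β v u = l * ∑ i, u i ^ 2 ∧ ∀ g, cyclicForm n β v g ≤ l * ∑ i, g i ^ 2 := by
  have hc : Continuous (fun g : EuclideanSpace ℝ (Fin (n + 1)) => cyclicForm n β v g.ofLp) := by
    unfold cyclicForm; fun_prop
  obtain ⟨u, hu, hmax⟩ := (isCompact_sphere (0 : EuclideanSpace ℝ (Fin (n + 1))) 1).exists_isMaxOn
    (NormedSpace.sphere_nonempty.2 zero_le_one) hc.continuousOn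
  have hn (g : EuclideanSpace ℝ (Fin (n + 1))) : ∑ i, g i ^ 2 = ‖g‖ ^ 2 := by
    rw [EuclideanSpace.norm_sq_eq]; simp
  have hu1 : ∑ i, u i ^ 2 = 1 := by rw [hn]; simp_all
  refine ⟨cyclicForm n β v u.ofLp, u.ofLp, by rw [hu1]; norm_num, by rw [hu1, mul_one], fun g => ?_⟩
  by_cases hg : WithLp.toLp 2 g = 0
  · have : g = 0 := by simpa using hg
    simp [this, cyclicForm]
  · have hpos : 0 < ‖WithLp.toLp 2 g‖ := norm_pos_iff.2 hg
    have hm := hmax (a := (‖WithLp.toLp 2 g‖)⁻¹ • WithLp.toLp 2 g) (by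
      simp [norm_smul, hpos.ne'])
    have hs : cyclicForm n β v ((‖WithLp.toLp 2 g‖)⁻¹ • WithLp.toLp 2 g).ofLp =
        (‖WithLp.toLp 2 g‖ ^ 2)⁻¹ * cyclicForm n β v g := by
      simp only [cyclicForm, Finset.mul_sum, WithLp.ofLp_smul, Pi.smul_apply, smul_eq_mul]
      exact Finset.sum_congr rfl fun i _ => by ring
    have hm : cyclicForm n β v ((‖WithLp.toLp 2 g‖)⁻¹ • WithLp.toLp 2 g).ofLp ≤
      cyclicForm n β v u.ofLp := hm
    rw [hs, inv_mul_le_iff₀ (by positivity)] at hm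
    have := hn (WithLp.toLp 2 g)
    simp only at this
    rw [this]
    linarith

/-- Maximality of `l` makes the matrix positive semidefinite; a vector on which a semidefinite form
vanishes lies in the kernel. -/
lemma det_cyclicMatrix_eq_zero {n : ℕ} {β v : ℕ → ℝ} {l : ℝ} {u : Fin (n + 1) → ℝ}
    (hu : 0 < ∑ i, u i ^ 2) (hul : cyclicForm n β v u = l * ∑ i, u i ^ 2)
    (hl : ∀ g, cyclicForm n β v g ≤ l * ∑ i, g i ^ 2) : (cyclicMatrix n β v l).det = 0 := by
  have hps : (cyclicMatrix n β v l).PosSemidef :=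
    .of_dotProduct_mulVec_nonneg (isHermitian_cyclicMatrix n β v l) fun g => by
      rw [star_trivial, dotProduct_cyclicMatrix_mulVec]
      linarith [hl g]
  refine exists_mulVec_eq_zero_iff.1 ⟨u, ?_, (hps.dotProduct_mulVec_zero_iff u).1 ?_⟩
  · rintro rfl; simp at hu
  · rw [star_trivial, dotProduct_cyclicMatrix_mulVec, hul, sub_self]

lemma det_cyclicMatrix_pos {n : ℕ} {β v : ℕ → ℝ} {l t : ℝ} (hlt : l < t)
    (hl : ∀ g, cyclicForm n β v g ≤ l * ∑ i, g i ^ 2) : 0 < (cyclicMatrix n β v t).det := by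
  refine (Matrix.PosDef.of_dotProduct_mulVec_pos (isHermitian_cyclicMatrix n β v t)
    fun g hg => ?_).det_pos
  rw [star_trivial, dotProduct_cyclicMatrix_mulVec]
  have : 0 < ∑ i, g i ^ 2 := by
    obtain ⟨i, hi⟩ := Function.ne_iff.1 hg
    exact Finset.sum_pos' (fun i _ => sq_nonneg _) ⟨i, mem_univ i, by have : g i ≠ 0 := hi; positivity⟩
  nlinarith [hl g]

/-- The corners are added to the existing entries, not written over them. This matters for `m = 0`,
where the corners coincide with the off-diagonal entries and both couplings `v 0`, `v 1` share one
place. -/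
lemma det_cyclicMatrix (m : ℕ) (β v : ℕ → ℝ) (t : ℝ) :
    (cyclicMatrix (m + 1) β v t).det =
      (tridiag (fun k => t - β k) (fun k => -v k) (fun k => -v k) (m + 2)).det
        - v (m + 1) ^ 2 * (tridiag (fun k => t - β (k + 1)) (fun k => -v (k + 1))
            (fun k => -v (k + 1)) m).det
        - 2 * ∏ j ∈ range (m + 2), v j := by
  have key := det_tridiag_updateRow_corners (fun k => t - β k) (fun k => -v k) (fun k => -v k) m
    (-v (m + 1)) (-v (m + 1))
  have hM : (((tridiag (fun k => t - β k) (fun k => -v k) (fun k => -v k) (m + 2)).updateRow 0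
        (tridiag (fun k => t - β k) (fun k => -v k) (fun k => -v k) (m + 2) 0 +
          (-v (m + 1)) • Pi.single (Fin.last (m + 1)) 1)).updateRow (Fin.last (m + 1))
        (tridiag (fun k => t - β k) (fun k => -v k) (fun k => -v k) (m + 2) (Fin.last (m + 1)) +
          (-v (m + 1)) • Pi.single 0 1)) = cyclicMatrix (m + 1) β v t := by
    clear key
    ext i j
    simp only [updateRow_apply, cyclicMatrix, tridiag, Matrix.of_apply, Pi.add_apply,
      Pi.smul_apply, Pi.single_apply, smul_eq_mul, Fin.ext_iff, Fin.val_add_one, Fin.val_zero,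
      Fin.val_last]
    have hi := i.2
    have hj := j.2
    split_ifs <;> first | omega | (simp_all; done) | (simp_all; ring)
  rw [hM] at key
  rw [key, Finset.prod_neg, Finset.prod_range_succ _ (m + 1), card_range]
  -- One sign is that of the corner cofactor, the other comes from the product of the entries `-v
  -- j`.
  have : (-1 : ℝ) ^ (m + 1) * (-1) ^ (m + 1) = 1 := by
    rw [← mul_pow]; simp
  linear_combination (-2 * v (m + 1) * ∏ j ∈ range (m + 1), v j) * this

/-! ### Upper bound by folding along residue classes -/

lemma summable_mul_of_sq {ι : Type*} {x y : ι → ℝ} (hx : Summable fun i => x i ^ 2)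
    (hy : Summable fun i => y i ^ 2) : Summable fun i => x i * y i := by
  refine Summable.of_norm_bounded (hx.add hy) fun i => ?_
  rw [Real.norm_eq_abs, abs_le]
  constructor <;> nlinarith [sq_nonneg (x i + y i), sq_nonneg (x i - y i)]

lemma tsum_mul_le_sqrt_mul_sqrt {ι : Type*} {x y : ι → ℝ} (hx0 : ∀ i, 0 ≤ x i) (hy0 : ∀ i, 0 ≤ y i)
    (hx : Summable fun i => x i ^ 2) (hy : Summable fun i => y i ^ 2) :
    ∑' i, x i * y i ≤ √(∑' i, x i ^ 2) * √(∑' i, y i ^ 2) := by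
  have := Real.inner_le_Lp_mul_Lq_tsum_of_nonneg Real.HolderConjugate.two_two hx0 hy0
    (by simpa using hx) (by simpa using hy)
  simpa [Real.sqrt_eq_rpow] using this

/-- Folding a square summable sequence along residue classes compares the quadratic form of a
periodic Jacobi operator with the cyclic form of one period. -/
lemma tsum_periodic_form_le {n : ℕ} {β v h : ℕ → ℝ} {l : ℝ} (hβ : Function.Periodic β (n + 1))
    (hv : Function.Periodic v (n + 1)) (hv0 : ∀ k, 0 ≤ v k) (hh0 : ∀ k, 0 ≤ h k)
    (hh : Summable fun k => h k ^ 2) (hl : ∀ g, cyclicForm n β v g ≤ l * ∑ i, g i ^ 2)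
    (hs : Summable fun k => β k * h k ^ 2 + 2 * (v k * (h k * h (k + 1)))) :
    ∑' k, (β k * h k ^ 2 + 2 * (v k * (h k * h (k + 1)))) ≤ l * ∑' k, h k ^ 2 := by
  have hinj (j : ℕ) : Function.Injective fun m : ℕ => j + (n + 1) * m := fun x y hxy => by
    simpa using hxy
  have hsj (j : ℕ) : Summable fun m => h (j + (n + 1) * m) ^ 2 := hh.comp_injective (hinj j)
  have hmj (j : ℕ) : Summable fun m => h (j + (n + 1) * m) * h (j + (n + 1) * m + 1) := by
    refine summable_mul_of_sq (hsj j) ?_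
    simpa only [add_right_comm] using hsj (j + 1)
  have hper {w : ℕ → ℝ} (hw : Function.Periodic w (n + 1)) (j m : ℕ) :
      w (j + (n + 1) * m) = w j := by
    have := hw.nat_mul m j
    rw [mul_comm]; simpa using this
  set g : Fin (n + 1) → ℝ := fun j => √(∑' m, h (j + (n + 1) * m) ^ 2) with hg
  have hg2 (j : Fin (n + 1)) : g j ^ 2 = ∑' m, h (j + (n + 1) * m) ^ 2 :=
    Real.sq_sqrt (tsum_nonneg fun m => sq_nonneg _)
  have hcs (j : Fin (n + 1)) :
      ∑' m, h (j + (n + 1) * m) * h (j + (n + 1) * m + 1) ≤ g j * g (j + 1) := by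
    have h1 : Summable fun m => h (j + (n + 1) * m + 1) ^ 2 := by
      simpa only [add_right_comm] using hsj (j + 1)
    refine (tsum_mul_le_sqrt_mul_sqrt (fun _ => hh0 _) (fun _ => hh0 _) (hsj j) h1).trans ?_
    refine mul_le_mul_of_nonneg_left ?_ (Real.sqrt_nonneg _)
    refine Real.sqrt_le_sqrt ?_
    rw [Fin.val_add_one]
    split_ifs with hj
    -- Wrap-around: the successors of the last class form class `0` without its first term, so the
    -- norm can only grow when that term is restored. For the other classes there is equality.
    · subst hj
      have : ∀ m, h ((Fin.last n : ℕ) + (n + 1) * m + 1) = h (0 + (n + 1) * (m + 1)) := fun m => by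
        congr 1; simp; ring
      simp only [this]
      rw [(hsj 0).tsum_eq_zero_add]
      exact le_add_of_nonneg_left (sq_nonneg _)
    · simp only [add_right_comm]; exact le_rfl
  rw [Nat.sumByResidueClasses hs (n + 1), Nat.sumByResidueClasses hh (n + 1)]
  have key : ∀ j : Fin (n + 1), ∑' m, (β (j + (n + 1) * m) * h (j + (n + 1) * m) ^ 2 +
      2 * (v (j + (n + 1) * m) * (h (j + (n + 1) * m) * h (j + (n + 1) * m + 1)))) ≤
      β j * g j ^ 2 + 2 * (v j * (g j * g (j + 1))) := fun j => by
    simp only [hper hβ, hper hv]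
    rw [((hsj j).mul_left _).tsum_add (((hmj j).mul_left _).mul_left _), tsum_mul_left,
      tsum_mul_left, tsum_mul_left, hg2]
    have := mul_le_mul_of_nonneg_left (hcs j) (hv0 j)
    linarith
  calc _ ≤ cyclicForm n β v g := Finset.sum_le_sum fun j _ => key j
    _ ≤ l * ∑ i, g i ^ 2 := hl g
    _ = _ := by simp only [hg2]; rfl

/-! ### The quadratic form of the real part of `ω T` -/

/-- The superdiagonal entry of the self-adjoint operator `Re (ω T)`. -/
noncomputable def hopping (ω : ℂ) (a c : ℕ → ℂ) (k : ℕ) : ℂ := (ω * c k + conj (ω * a (k + 1))) / 2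

variable {n : ℕ} {a b c : ℕ → ℂ} (ha : Function.Periodic a (n + 1))
  (hb : Function.Periodic b (n + 1)) (hc : Function.Periodic c (n + 1))

/-- The `a`-terms are shifted by one index, so that `a (k + 1)` and `c k`, which couple the same
sites `k` and `k + 1`, stand in the same summand. Conjugation inside the real part then merges them
into `hopping`. -/
lemma hasSum_re_mul_inner_tridiagOp (ω : ℂ) (f : EllTwo) :
    HasSum (fun k => (ω * b k).re * ‖f k‖ ^ 2
        + 2 * (hopping ω a c k * (conj (f k) * f (k + 1))).re)
      (ω * inner ℂ f (tridiagOp ha hb hc f)).re := by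
  have h1 := Complex.hasSum_re ((lp.hasSum_inner f (tridiagOp ha hb hc f)).mul_left ω)
  have hz : Function.Periodic (fun _ : ℕ => (0 : ℂ)) (n + 1) := fun _ => rfl
  -- The operator with `b = c = 0` isolates the `a`-part; its series is subtracted and added back
  -- shifted, at no cost because its term at `0` vanishes.
  obtain ⟨S, h2⟩ := (lp.summable_inner f (tridiagOp ha hz hz f)).mul_left ω
  have h2 := Complex.hasSum_re h2
  have h3 := (hasSum_nat_add_iff' 1).2 h2
  have h0 : ∑ i ∈ range 1, (ω * inner ℂ (f i) (tridiagOp ha hz hz f i)).re = 0 := by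
    simp [tridiagOp_apply]
  rw [h0, sub_zero] at h3
  have h4 := (h1.sub h2).add h3
  rw [sub_add_cancel] at h4
  refine h4.congr_fun fun k => ?_
  simp only [tridiagOp_apply, RCLike.inner_apply]
  have hn : ((‖f k‖ ^ 2 : ℝ) : ℂ) = f k * conj (f k) := by
    rw [Complex.mul_conj']; push_cast; rfl
  have e1 : (ω * b k).re * ‖f k‖ ^ 2 = (ω * (b k * f k * conj (f k))).re := by
    rw [← Complex.re_mul_ofReal, hn]; ring_nf
  have e2 : 2 * (hopping ω a c k * (conj (f k) * f (k + 1))).re =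
      (ω * (c k * f (k + 1) * conj (f k))).re
        + (ω * (a (k + 1) * f k * conj (f (k + 1)))).re := by
    rw [← Complex.conj_re (ω * (a (k + 1) * f k * conj (f (k + 1)))), ← Complex.add_re,
      ← Complex.re_ofReal_mul]
    congr 1
    simp only [hopping, map_mul, Complex.conj_conj]
    push_cast
    ring
  rw [e1, e2]
  simp only [Nat.succ_ne_zero, if_false, Nat.add_sub_cancel, zero_mul, add_zero, add_mul, mul_add,
    Complex.add_re]
  ring

lemma hasSum_norm_sq (f : EllTwo) : HasSum (fun k => ‖f k‖ ^ 2) (‖f‖ ^ 2) := by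
  have := lp.hasSum_norm (p := 2) (by norm_num) f
  simpa using this


lemma periodic_norm_hopping {n : ℕ} {a c : ℕ → ℂ} (ha : Function.Periodic a (n + 1))
    (hc : Function.Periodic c (n + 1)) (ω : ℂ) :
    Function.Periodic (fun k => ‖hopping ω a c k‖) (n + 1) := fun k => by
  simp only [hopping, hc k, show k + (n + 1) + 1 = k + 1 + (n + 1) by ring, ha (k + 1)]

/-- The numerical range is bounded by the largest Rayleigh quotient of the cyclic form. -/
lemma re_mul_inner_tridiagOp_le (ω : ℂ) {l : ℝ}
    (hl : ∀ g, cyclicForm n (fun k => (ω * b k).re) (fun k => ‖hopping ω a c k‖) g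
      ≤ l * ∑ i, g i ^ 2) (f : EllTwo) :
    (ω * inner ℂ f (tridiagOp ha hb hc f)).re ≤ l * ‖f‖ ^ 2 := by
  have hβ : Function.Periodic (fun k => (ω * b k).re) (n + 1) := fun k => by simp only [hb k]
  have hv := periodic_norm_hopping ha hc ω
  have h2 := (hasSum_norm_sq f).summable
  have h3 : Summable fun k => ‖f k‖ * ‖f (k + 1)‖ :=
    summable_mul_of_sq h2 ((summable_nat_add_iff 1).2 h2)
  obtain ⟨B, hB⟩ : ∃ B : ℝ, ∀ k, ‖((ω * b k).re : ℂ)‖ ≤ B :=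
    exists_bound_of_periodic (n := n) fun k => by simp only [hb k]
  obtain ⟨V, hV⟩ : ∃ V : ℝ, ∀ k, ‖((‖hopping ω a c k‖ : ℝ) : ℂ)‖ ≤ V :=
    exists_bound_of_periodic (n := n) fun k => by simpa using hv k
  simp only [Complex.norm_real] at hB hV
  have hs : Summable fun k => (ω * b k).re * ‖f k‖ ^ 2
      + 2 * (‖hopping ω a c k‖ * (‖f k‖ * ‖f (k + 1)‖)) := by
    refine Summable.add (.of_norm_bounded (h2.mul_left B) fun k => ?_)
      (Summable.mul_left 2 (.of_norm_bounded (h3.mul_left V) fun k => ?_))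
    · rw [norm_mul, Real.norm_of_nonneg (sq_nonneg ‖f k‖)]
      exact mul_le_mul_of_nonneg_right (hB k) (sq_nonneg _)
    · rw [norm_mul, Real.norm_of_nonneg (by positivity : 0 ≤ ‖f k‖ * ‖f (k + 1)‖)]
      exact mul_le_mul_of_nonneg_right (hV k) (by positivity)
  have key := tsum_periodic_form_le hβ hv (fun _ => norm_nonneg _) (fun _ => norm_nonneg _) h2 hl hs
  rw [(hasSum_norm_sq f).tsum_eq] at key
  refine (hasSum_le (fun k => ?_) (hasSum_re_mul_inner_tridiagOp ha hb hc ω f) hs.hasSum).trans key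
  -- Passing to absolute values discards all phases and leaves the form with couplings `‖hopping ω a
  -- c k‖` at `|f|`.
  have := Complex.re_le_norm (hopping ω a c k * (conj (f k) * f (k + 1)))
  rw [norm_mul, norm_mul, RCLike.norm_conj] at this
  linarith

/-! ### Lower bound by truncated periodic sequences -/

/-- Unimodular numbers whose diagonal conjugation makes the sequence `w` nonnegative. -/
noncomputable def gauge (w : ℕ → ℂ) : ℕ → ℂ
  | 0 => 1
  | k + 1 => gauge w k * (if w k = 0 then 1 else conj (w k) / ‖w k‖)

lemma norm_gauge (w : ℕ → ℂ) (k : ℕ) : ‖gauge w k‖ = 1 := by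
  induction k with
  | zero => simp [gauge]
  | succ k ih =>
    rw [gauge, norm_mul, ih]
    split_ifs with h
    · simp
    · simp [h]

lemma conj_gauge_mul_mul_gauge (w : ℕ → ℂ) (k : ℕ) :
    conj (gauge w k) * w k * gauge w (k + 1) = ‖w k‖ := by
  have h1 : conj (gauge w k) * gauge w k = 1 := by
    rw [Complex.conj_mul', norm_gauge]; simp
  rw [gauge]
  split_ifs with h
  · simp [h]
  · have h0 : (‖w k‖ : ℂ) ≠ 0 := by simpa using h
    have h2 := Complex.mul_conj' (w k)
    field_simp
    linear_combination (w k * conj (w k)) * h1 + h2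

lemma sum_range_mul_of_periodic {F : ℕ → ℝ} {N : ℕ} (hF : Function.Periodic F N) (M : ℕ) :
    ∑ k ∈ range (M * N), F k = M * ∑ k ∈ range N, F k := by
  induction M with
  | zero => simp
  | succ M ih =>
    rw [Nat.succ_mul, Finset.sum_range_add, ih]
    have (k : ℕ) : F (M * N + k) = F k := by
      rw [add_comm]; simpa using hF.nat_mul M k
    simp only [this]
    push_cast; ring

/-- Truncated periodic sequences come arbitrarily close to the largest Rayleigh quotient of the
cyclic form. -/
lemma exists_re_mul_inner_tridiagOp_ge (ω : ℂ) (u : Fin (n + 1) → ℝ) :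
    ∃ C : ℝ, ∀ M : ℕ, ∃ f : EllTwo, ‖f‖ ^ 2 = M * ∑ i, u i ^ 2 ∧
      M * cyclicForm n (fun k => (ω * b k).re) (fun k => ‖hopping ω a c k‖) u - C
        ≤ (ω * inner ℂ f (tridiagOp ha hb hc f)).re := by
  set β : ℕ → ℝ := fun k => (ω * b k).re with hβd
  set v : ℕ → ℝ := fun k => ‖hopping ω a c k‖ with hvd
  have hβ : Function.Periodic β (n + 1) := fun k => by simp only [hβd, hb k]
  have hv : Function.Periodic v (n + 1) := periodic_norm_hopping ha hc ω
  set U : ℕ → ℝ := fun k => u (Fin.ofNat (n + 1) k) with hUd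
  have hU : Function.Periodic U (n + 1) := fun k => by
    simp only [hUd]; congr 1; ext; simp
  set e := gauge (hopping ω a c) with he
  set E : ℕ → ℝ := fun k => 2 * (v k * (U k * U (k + 1))) with hEd
  have hE : Function.Periodic E (n + 1) := fun k => by
    simp only [hEd, hv k, hU k, show k + (n + 1) + 1 = k + 1 + (n + 1) by ring, hU (k + 1)]
  have hform : cyclicForm n β v u = ∑ k ∈ range (n + 1), (β k * U k ^ 2 + E k) := by
    rw [cyclicForm, ← Fin.sum_univ_eq_sum_range]
    refine Finset.sum_congr rfl fun i _ => ?_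
    have h1 : Fin.ofNat (n + 1) (i : ℕ) = i := by ext; simp
    have h2 : Fin.ofNat (n + 1) ((i : ℕ) + 1) = i + 1 := by ext; simp [Fin.val_add]
    simp only [hEd, hUd, h1, h2]
  have hsq : ∑ i, u i ^ 2 = ∑ k ∈ range (n + 1), U k ^ 2 := by
    rw [← Fin.sum_univ_eq_sum_range (fun k => U k ^ 2)]
    refine Finset.sum_congr rfl fun i _ => ?_
    have h1 : Fin.ofNat (n + 1) (i : ℕ) = i := by ext; simp
    simp only [hUd, h1]
  -- Truncation cuts only the coupling from the last site `K - 1` to `K`; by periodicity it is worth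
  -- `E n`, whatever `M ≥ 1` is.
  refine ⟨|E n|, fun M => ?_⟩
  set K := M * (n + 1) with hK
  set φ : ℕ → ℂ := fun k => if k < K then U k * e k else 0 with hφ
  have hφ2 (k : ℕ) : ‖φ k‖ ^ 2 = if k < K then U k ^ 2 else 0 := by
    simp only [hφ]
    split_ifs
    · simp [he, norm_gauge]
    · simp
  have hsum2 : HasSum (fun k => ‖φ k‖ ^ 2) (∑ k ∈ range K, U k ^ 2) := by
    have h := hasSum_sum_of_ne_finset_zero (L := .unconditional ℕ) (f := fun k => ‖φ k‖ ^ 2) (s := range K)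
      fun k hk => by rw [hφ2, if_neg (by simpa using hk)]
    rwa [Finset.sum_congr rfl fun k hk => by rw [hφ2, if_pos (by simpa using hk)]] at h
  let f : EllTwo := ⟨φ, (memℓp_two_iff φ).2 hsum2.summable⟩
  have hfk (k : ℕ) : f k = φ k := rfl
  refine ⟨f, ?_, ?_⟩
  · rw [(hasSum_norm_sq f).unique hsum2, hsq, hK,
      sum_range_mul_of_periodic (F := fun k => U k ^ 2) (fun k => by simp only [hU k])]
  · have h1 := hasSum_re_mul_inner_tridiagOp ha hb hc ω f
    have hterm (k : ℕ) : (ω * b k).re * ‖f k‖ ^ 2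
        + 2 * (hopping ω a c k * (conj (f k) * f (k + 1))).re =
        if k < K then β k * U k ^ 2 + E k - (if k + 1 = K then E k else 0) else 0 := by
      rw [hfk, hfk, hφ2]
      by_cases hk : k + 1 < K
      · have hk' : k < K := by omega
        have := conj_gauge_mul_mul_gauge (hopping ω a c) k
        have h2 : hopping ω a c k * (conj (φ k) * φ (k + 1)) =
            ((v k * (U k * U (k + 1)) : ℝ) : ℂ) := by
          simp only [hφ, if_pos hk, if_pos hk', map_mul, Complex.conj_ofReal]
          push_cast
          rw [← this]; ring
        rw [h2, if_pos hk', if_pos hk', if_neg hk.ne, Complex.ofReal_re]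
        simp [hβd, hEd]
      · have h2 : φ (k + 1) = 0 := if_neg hk
        rw [h2]
        by_cases hk' : k < K
        · have : k + 1 = K := by omega
          simp [hk', this, hβd]
        · simp [hk']
    have h2 := hasSum_sum_of_ne_finset_zero (L := .unconditional ℕ) (s := range K) (f := fun k => (ω * b k).re * ‖f k‖ ^ 2
        + 2 * (hopping ω a c k * (conj (f k) * f (k + 1))).re) fun k hk => by
      rw [hterm, if_neg (by simpa using hk)]
    rw [h1.unique h2, Finset.sum_congr rfl fun k hk => by rw [hterm, if_pos (by simpa using hk)],
      Finset.sum_sub_distrib, hK, sum_range_mul_of_periodic fun k => by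
        simp only [hβ k, hU k, hE k], ← hK, hform]
    refine sub_le_sub_left ?_ _
    rcases M with _ | M
    · simp [hK]
    · have hK1 : K = M * (n + 1) + n + 1 := by rw [hK]; ring
      have hEn : E (M * (n + 1) + n) = E n := by
        rw [add_comm]; simpa using hE.nat_mul M n
      rw [hK1, Finset.sum_range_succ, if_pos rfl, hEn, Finset.sum_eq_zero, zero_add]
      · exact le_abs_self _
      · intro k hk
        rw [Finset.mem_range] at hk
        rw [if_neg (by omega)]

/-! ### Homogeneity and reality of `P` -/

/-- Monomials are real at real points, so it suffices to take real parts of the coefficients. As the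
values of `P` are real (`conj_P`), nothing is lost. -/
lemma exists_real_mvPolynomial_eval_eq_re {σ : Type*} {m : ℕ} {q : MvPolynomial σ ℂ}
    (hq : q.IsHomogeneous m) : ∃ p : MvPolynomial σ ℝ, p.IsHomogeneous m ∧
      ∀ z : σ → ℝ, MvPolynomial.eval z p = (MvPolynomial.eval (fun i => (z i : ℂ)) q).re := by
  refine ⟨∑ s ∈ q.support, MvPolynomial.monomial s (q.coeff s).re,
    MvPolynomial.IsHomogeneous.sum _ _ _ fun s hs => ?_, fun z => ?_⟩
  · refine MvPolynomial.isHomogeneous_monomial _ ?_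
    rw [Finsupp.degree_eq_weight_one]
    exact hq (MvPolynomial.mem_support_iff.1 hs)
  · rw [map_sum, MvPolynomial.eval_eq, Complex.re_sum]
    refine Finset.sum_congr rfl fun s _ => ?_
    rw [MvPolynomial.eval_monomial, ← Complex.re_mul_ofReal, Finsupp.prod]
    push_cast
    rfl

lemma isHomogeneous_det {σ R : Type*} [CommRing R] {m : ℕ}
    (A : Matrix (Fin m) (Fin m) (MvPolynomial σ R)) (hA : ∀ i j, (A i j).IsHomogeneous 1) :
    A.det.IsHomogeneous m := by
  rw [det_apply]
  refine MvPolynomial.IsHomogeneous.sum _ _ _ fun s _ => ?_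
  have h : (∏ i, A (s i) i).IsHomogeneous (∑ _i : Fin m, 1) :=
    MvPolynomial.IsHomogeneous.prod _ _ _ fun i _ => hA _ _
  rw [Finset.sum_const, card_univ, Fintype.card_fin, smul_eq_mul, mul_one] at h
  rw [Units.smul_def, ← Int.cast_smul_eq_zsmul R, MvPolynomial.smul_eq_C_mul]
  have := (MvPolynomial.isHomogeneous_C σ ((Equiv.Perm.sign s : ℤ) : R)).mul h
  rwa [zero_add] at this

open MvPolynomial in
/-- The entries of the tridiagonal matrices as linear forms. -/
noncomputable def entryPoly (n : ℕ) (a b c : ℕ → ℂ) (i j : ℕ) : MvPolynomial (Fin 3) ℂ :=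
  if j = i then X 0 + C ((b i).re : ℂ) * X 1 + C ((b i).im : ℂ) * X 2
  else if j = i + 1 then C (alpha n a c i) * X 1 + C (gamma n a c i) * X 2
  else if i = j + 1 then C (conj (alpha n a c j)) * X 1 + C (conj (gamma n a c j)) * X 2
  else 0

lemma isHomogeneous_C_mul_X_one (z : ℂ) (i : Fin 3) :
    (MvPolynomial.C z * MvPolynomial.X i : MvPolynomial (Fin 3) ℂ).IsHomogeneous 1 := by
  simpa using (MvPolynomial.isHomogeneous_C (Fin 3) z).mul (MvPolynomial.isHomogeneous_X ℂ i)

lemma isHomogeneous_entryPoly (n : ℕ) (a b c : ℕ → ℂ) (i j : ℕ) :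
    (entryPoly n a b c i j).IsHomogeneous 1 := by
  unfold entryPoly
  split_ifs
  · exact ((MvPolynomial.isHomogeneous_X ℂ 0).add (isHomogeneous_C_mul_X_one _ _)).add
      (isHomogeneous_C_mul_X_one _ _)
  · exact (isHomogeneous_C_mul_X_one _ _).add (isHomogeneous_C_mul_X_one _ _)
  · exact (isHomogeneous_C_mul_X_one _ _).add (isHomogeneous_C_mul_X_one _ _)
  · exact MvPolynomial.isHomogeneous_zero _ _ _

lemma eval_entryPoly (n : ℕ) (a b c : ℕ → ℂ) (t x y : ℝ) (i j : ℕ) :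
    MvPolynomial.eval (fun k => ((![t, x, y] k : ℝ) : ℂ)) (entryPoly n a b c i j) =
      entry n a b c t x y i j := by
  unfold entryPoly entry
  split_ifs <;> simp

/-- Hermitian symmetry at real `t, x, y`: this is what makes `G`, `H` and `P` real. -/
lemma conj_entry (n : ℕ) (a b c : ℕ → ℂ) (t x y : ℝ) (i j : ℕ) :
    conj (entry n a b c t x y i j) = entry n a b c t x y j i := by
  unfold entry
  split_ifs <;> first | omega | simp_all

lemma conj_G (n : ℕ) (a b c : ℕ → ℂ) (t x y : ℝ) : conj (G n a b c t x y) = G n a b c t x y := by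
  unfold G
  rw [starRingEnd_apply, ← det_conjTranspose]
  congr 1
  ext i j
  exact conj_entry n a b c t x y j i

lemma conj_H (n : ℕ) (a b c : ℕ → ℂ) (t x y : ℝ) : conj (H n a b c t x y) = H n a b c t x y := by
  unfold H
  rw [starRingEnd_apply, ← det_conjTranspose]
  congr 1
  ext i j
  exact conj_entry n a b c t x y (j + 1) (i + 1)

lemma conj_P (n : ℕ) (a b c : ℕ → ℂ) (t x y : ℝ) : conj (P n a b c t x y) = P n a b c t x y := by
  simp only [P, map_sub, map_pow, map_mul, map_prod, conj_G, conj_H, Complex.conj_ofReal,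
    Complex.conj_ofNat]

open MvPolynomial in
/-- The squared norm of an off-diagonal entry as a quadratic form. -/
noncomputable def normSqPoly (n : ℕ) (a c : ℕ → ℂ) (j : ℕ) : MvPolynomial (Fin 3) ℂ :=
  (C (alpha n a c j) * X 1 + C (gamma n a c j) * X 2)
    * (C (conj (alpha n a c j)) * X 1 + C (conj (gamma n a c j)) * X 2)

lemma isHomogeneous_normSqPoly (n : ℕ) (a c : ℕ → ℂ) (j : ℕ) :
    (normSqPoly n a c j).IsHomogeneous 2 :=
  ((isHomogeneous_C_mul_X_one _ _).add (isHomogeneous_C_mul_X_one _ _)).mul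
    ((isHomogeneous_C_mul_X_one _ _).add (isHomogeneous_C_mul_X_one _ _))

lemma eval_normSqPoly (n : ℕ) (a c : ℕ → ℂ) (t x y : ℝ) (j : ℕ) :
    MvPolynomial.eval (fun k => ((![t, x, y] k : ℝ) : ℂ)) (normSqPoly n a c j) =
      ((‖alpha n a c j * x + gamma n a c j * y‖ ^ 2 : ℝ) : ℂ) := by
  rw [Complex.ofReal_pow, ← Complex.mul_conj']
  simp [normSqPoly]

theorem exists_homogeneous_P (n : ℕ) (hn : 1 ≤ n) (a b c : ℕ → ℂ) :
    ∃ p : MvPolynomial (Fin 3) ℝ, p.IsHomogeneous (2 * (n + 1)) ∧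
      ∀ t x y : ℝ, P n a b c t x y = ((MvPolynomial.eval ![t, x, y] p : ℝ) : ℂ) := by
  set g : MvPolynomial (Fin 3) ℂ :=
    (Matrix.of fun i j : Fin (n + 1) => entryPoly n a b c i j).det with hg
  set h : MvPolynomial (Fin 3) ℂ :=
    (Matrix.of fun i j : Fin (n - 1) => entryPoly n a b c (i + 1) (j + 1)).det with hh
  have hgh : g.IsHomogeneous (n + 1) := isHomogeneous_det _ fun i j => isHomogeneous_entryPoly ..
  have hhh : h.IsHomogeneous (n - 1) := isHomogeneous_det _ fun i j => isHomogeneous_entryPoly ..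
  have h1 : (g - normSqPoly n a c n * h).IsHomogeneous (n + 1) := by
    refine hgh.sub ?_
    have := (isHomogeneous_normSqPoly n a c n).mul hhh
    -- The truncated subtraction is harmless since `1 ≤ n`.
    rwa [show 2 + (n - 1) = n + 1 by omega] at this
  have h2 : (∏ j ∈ range (n + 1), normSqPoly n a c j).IsHomogeneous (2 * (n + 1)) := by
    have := MvPolynomial.IsHomogeneous.prod (range (n + 1)) (normSqPoly n a c) (fun _ => 2)
      fun j _ => isHomogeneous_normSqPoly n a c j
    rwa [Finset.sum_const, card_range, smul_eq_mul, mul_comm (n + 1) 2] at this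
  have h3 : ((g - normSqPoly n a c n * h) ^ 2 - MvPolynomial.C 4 *
      ∏ j ∈ range (n + 1), normSqPoly n a c j).IsHomogeneous (2 * (n + 1)) := by
    refine .sub ?_ ?_
    · have := h1.pow 2
      rwa [mul_comm (n + 1) 2] at this
    · have := (MvPolynomial.isHomogeneous_C (Fin 3) (4 : ℂ)).mul h2
      rwa [zero_add] at this
  obtain ⟨p, hp, hpe⟩ := exists_real_mvPolynomial_eval_eq_re h3
  refine ⟨p, hp, fun t x y => ?_⟩
  have hG : MvPolynomial.eval (fun k => ((![t, x, y] k : ℝ) : ℂ)) g = G n a b c t x y := by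
    rw [hg, RingHom.map_det, G]
    congr 1
    ext i j
    exact eval_entryPoly ..
  have hH : MvPolynomial.eval (fun k => ((![t, x, y] k : ℝ) : ℂ)) h = H n a b c t x y := by
    rw [hh, RingHom.map_det, H]
    congr 1
    ext i j
    exact eval_entryPoly ..
  have hP : MvPolynomial.eval (fun k => ((![t, x, y] k : ℝ) : ℂ))
      ((g - normSqPoly n a c n * h) ^ 2 - MvPolynomial.C 4 *
        ∏ j ∈ range (n + 1), normSqPoly n a c j) = P n a b c t x y := by
    simp only [map_sub, map_pow, map_mul, map_prod, hG, hH, eval_normSqPoly, MvPolynomial.eval_C, P]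
  rw [hpe, hP]
  exact (Complex.conj_eq_iff_re.1 (conj_P n a b c t x y)).symm

theorem P_zero_zero (n : ℕ) (a b c : ℕ → ℂ) (t : ℝ) :
    P n a b c t 0 0 = ((t ^ (2 * (n + 1)) : ℝ) : ℂ) := by
  have h : (Matrix.of fun i j : Fin (n + 1) => entry n a b c t 0 0 i j) =
      Matrix.diagonal fun _ => (t : ℂ) := by
    ext i j
    by_cases hij : j = i
    · simp [entry, hij]
    · have : ¬ (j : ℕ) = i := fun h => hij (Fin.ext h)
      simp [entry, this, Matrix.diagonal_apply_ne' _ hij]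
  simp only [P, G, h, det_diagonal]
  simp
  ring

/-! ### Factorization of `P` at `(t, -cos θ, -sin θ)` -/

lemma alpha_gamma_eq_neg_hopping {n : ℕ} {a c : ℕ → ℂ} {k : ℕ} (hk : k < n) (θ : ℝ) :
    alpha n a c k * ((-Real.cos θ : ℝ) : ℂ) + gamma n a c k * ((-Real.sin θ : ℝ) : ℂ) =
      -hopping (Complex.exp (-(Complex.I * θ))) a c k := by
  have h1 : Complex.exp (-(Complex.I * θ)) = Complex.cos θ - Complex.sin θ * Complex.I := by
    rw [mul_comm, ← neg_mul, Complex.exp_mul_I, Complex.cos_neg, Complex.sin_neg]; ring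
  have h2 : conj (Complex.exp (-(Complex.I * θ))) = Complex.cos θ + Complex.sin θ * Complex.I := by
    rw [h1]
    simp [← Complex.ofReal_cos, ← Complex.ofReal_sin]
  simp only [alpha, gamma, if_pos hk, hopping, map_mul, h2]
  rw [h1]
  push_cast
  have hI : (c k - conj (a (k + 1))) / (2 * Complex.I) =
      -Complex.I * (c k - conj (a (k + 1))) / 2 := by
    field_simp
    rw [Complex.I_sq]; ring
  rw [hI]; ring

/-- At index `n` the roles of `a` and `c` are exchanged, which conjugates the entry and keeps its
norm. The previous lemma is applied with `n + 1` for `n`, so that index `n` falls under the generic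
formula, with `a (n + 1) = a 0`. -/
lemma norm_alpha_gamma_last {n : ℕ} {a c : ℕ → ℂ} (ha : Function.Periodic a (n + 1)) (θ : ℝ) :
    ‖alpha n a c n * ((-Real.cos θ : ℝ) : ℂ) + gamma n a c n * ((-Real.sin θ : ℝ) : ℂ)‖ =
      ‖hopping (Complex.exp (-(Complex.I * θ))) a c n‖ := by
  have h := alpha_gamma_eq_neg_hopping (a := a) (c := c) (Nat.lt_succ_self n) θ
  have ha0 : a (n + 1) = a 0 := by simpa using ha 0
  rw [← norm_neg (hopping _ a c n), ← h, ← RCLike.norm_conj]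
  congr 1
  simp only [alpha, gamma, if_pos (Nat.lt_succ_self n), lt_irrefl, if_false, ha0, map_add, map_mul,
    Complex.conj_ofReal, map_div₀, map_sub, Complex.conj_conj, Complex.conj_I, map_ofNat]
  ring_nf

lemma re_add_im_eq_re_exp_mul (z : ℂ) (θ : ℝ) :
    (Complex.exp (-(Complex.I * θ)) * z).re = Real.cos θ * z.re + Real.sin θ * z.im := by
  rw [mul_comm Complex.I, ← neg_mul, Complex.exp_mul_I, Complex.cos_neg, Complex.sin_neg]
  simp [← Complex.ofReal_cos, ← Complex.ofReal_sin]

lemma entry_eq_tridiag {n : ℕ} (a b c : ℕ → ℂ) (θ t : ℝ) {i j : ℕ} (hi : i ≤ n) (hj : j ≤ n) :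
    entry n a b c t (-Real.cos θ) (-Real.sin θ) i j =
      if j = i then ((t - (Complex.exp (-(Complex.I * θ)) * b i).re : ℝ) : ℂ)
      else if j = i + 1 then -hopping (Complex.exp (-(Complex.I * θ))) a c i
      else if i = j + 1 then conj (-hopping (Complex.exp (-(Complex.I * θ))) a c j) else 0 := by
  unfold entry
  split_ifs with h1 h2 h3
  · rw [re_add_im_eq_re_exp_mul]; congr 1; ring
  · exact alpha_gamma_eq_neg_hopping (by omega) θ
  · rw [← alpha_gamma_eq_neg_hopping (n := n) (by omega) θ]
    simp only [map_add, map_mul, Complex.conj_ofReal]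
  · rfl

lemma det_tridiag_neg_eq_ofReal (β : ℕ → ℝ) (w e : ℕ → ℂ) (he : ∀ k, ‖e k‖ = 1)
    (h : ∀ k, conj (e k) * w k * e (k + 1) = ‖w k‖) (m : ℕ) :
    (tridiag (fun k => (β k : ℂ)) (fun k => -w k) (fun k => conj (-w k)) m).det =
      ((tridiag β (fun k => -‖w k‖) (fun k => -‖w k‖) m).det : ℝ) := by
  rw [det_tridiag_gauge _ _ e he (fun k => -(‖w k‖ : ℂ)) (fun k => by simp)
    (fun k => by rw [← h]; ring)]
  change _ = Complex.ofRealHom _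
  rw [RingHom.map_det]
  congr 1
  ext i j
  simp only [tridiag, Matrix.of_apply, RingHom.mapMatrix_apply, Matrix.map_apply,
    Complex.ofRealHom_eq_coe]
  split_ifs <;> simp

/-- `P` as the value of a real factorization whose first factor is the determinant of the cyclic
matrix. -/
lemma P_eq_det_cyclicMatrix_mul {n : ℕ} (hn : 1 ≤ n) {a b c : ℕ → ℂ}
    (ha : Function.Periodic a (n + 1)) (θ t : ℝ) {β v : ℕ → ℝ}
    (hβ : β = fun k => (Complex.exp (-(Complex.I * θ)) * b k).re)
    (hv : v = fun k => ‖hopping (Complex.exp (-(Complex.I * θ))) a c k‖) :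
    P n a b c t (-Real.cos θ) (-Real.sin θ) =
      (((cyclicMatrix n β v t).det *
        ((cyclicMatrix n β v t).det + 4 * ∏ j ∈ range (n + 1), v j) : ℝ) : ℂ) := by
  obtain ⟨m, rfl⟩ : ∃ m, n = m + 1 := ⟨n - 1, by omega⟩
  set w := hopping (Complex.exp (-(Complex.I * θ))) a c with hw
  have hG : G (m + 1) a b c t (-Real.cos θ) (-Real.sin θ) =
      ((tridiag (fun k => t - β k) (fun k => -v k) (fun k => -v k) (m + 2)).det : ℝ) := by
    rw [hv, ← det_tridiag_neg_eq_ofReal _ w (gauge w) (norm_gauge w)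
      (conj_gauge_mul_mul_gauge w), G]
    congr 1
    ext i j
    rw [Matrix.of_apply, entry_eq_tridiag a b c θ t (by omega) (by omega), hβ]
    rfl
  have hH : H (m + 1) a b c t (-Real.cos θ) (-Real.sin θ) =
      ((tridiag (fun k => t - β (k + 1)) (fun k => -v (k + 1)) (fun k => -v (k + 1)) m).det : ℝ) := by
    -- The inner block starts at index `1`, so the same gauge is used, shifted by one.
    rw [hv, ← det_tridiag_neg_eq_ofReal _ (fun k => w (k + 1)) (fun k => gauge w (k + 1))
      (fun k => norm_gauge w (k + 1)) (fun k => conj_gauge_mul_mul_gauge w (k + 1)), H]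
    congr 1
    ext i j
    have hi := i.2
    have hj := j.2
    rw [Matrix.of_apply, entry_eq_tridiag a b c θ t (by omega) (by omega), hβ]
    simp only [tridiag, Matrix.of_apply, Nat.add_right_cancel_iff]
    rfl
  have hprod : ∏ j ∈ range (m + 1 + 1), ((‖alpha (m + 1) a c j * ((-Real.cos θ : ℝ) : ℂ)
      + gamma (m + 1) a c j * ((-Real.sin θ : ℝ) : ℂ)‖ ^ 2 : ℝ) : ℂ) =
      (((∏ j ∈ range (m + 1 + 1), v j) ^ 2 : ℝ) : ℂ) := by
    rw [← Finset.prod_pow, Complex.ofReal_prod]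
    refine Finset.prod_congr rfl fun j hj => ?_
    rw [Finset.mem_range] at hj
    rcases Nat.lt_succ_iff_lt_or_eq.1 hj with h | rfl
    · rw [alpha_gamma_eq_neg_hopping h, norm_neg, hv]
    · rw [norm_alpha_gamma_last ha, hv]
  rw [P, hG, hH, hprod, norm_alpha_gamma_last ha, det_cyclicMatrix]
  rw [show ‖hopping (Complex.exp (-(Complex.I * θ))) a c (m + 1)‖ = v (m + 1) by rw [hv]]
  push_cast
  ring

end PeriodicTridiagonal

/-! ### The support function as the largest root -/

theorem proposition2p4 (n : ℕ) (hn : 1 ≤ n) (a b c : ℕ → ℂ)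
    (ha : Function.Periodic a (n + 1)) (hb : Function.Periodic b (n + 1))
    (hc : Function.Periodic c (n + 1)) :
    (∃ p : MvPolynomial (Fin 3) ℝ, p.IsHomogeneous (2 * (n + 1)) ∧
      ∀ t x y : ℝ, PeriodicTridiagonal.P n a b c t x y = ((MvPolynomial.eval ![t, x, y] p : ℝ) : ℂ)) ∧
    (∀ t : ℝ, PeriodicTridiagonal.P n a b c t 0 0 = ((t ^ (2 * (n + 1)) : ℝ) : ℂ)) ∧
    ∀ θ : ℝ, ∃ m : ℝ,
      IsLUB {s : ℝ | ∃ z ∈ PeriodicTridiagonal.numericalRange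
          (PeriodicTridiagonal.tridiagOp ha hb hc),
          (Complex.exp (-(Complex.I * θ)) * z).re = s} m ∧
      IsGreatest {t : ℝ |
          PeriodicTridiagonal.P n a b c t (-Real.cos θ) (-Real.sin θ) = 0} m := by
  open PeriodicTridiagonal in
  refine ⟨exists_homogeneous_P n hn a b c, P_zero_zero n a b c, fun θ => ?_⟩
  set ω := Complex.exp (-(Complex.I * θ)) with hω
  obtain ⟨l, u, hu, hul, hl⟩ := exists_max_cyclicForm n (fun k => (ω * b k).re)
    (fun k => ‖hopping ω a c k‖)
  refine ⟨l, ⟨?_, ?_⟩, ?_, ?_⟩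
  · rintro s ⟨z, ⟨f, hf, rfl⟩, rfl⟩
    have := re_mul_inner_tridiagOp_le ha hb hc ω hl f
    rwa [hf, one_pow, mul_one] at this
  · intro s hs
    obtain ⟨C, hC⟩ := exists_re_mul_inner_tridiagOp_ge ha hb hc ω u
    rw [hul] at hC
    by_contra! hsl
    have hd : 0 < (l - s) * ∑ i, u i ^ 2 := mul_pos (sub_pos.2 hsl) hu
    -- `M` makes the gain `M (l - s) ∑ u i ^ 2` exceed the truncation loss `C`; `M > 0` keeps `f`
    -- nonzero, so that it can be normalized.
    obtain ⟨M, hM⟩ := exists_nat_gt (max 0 (C / ((l - s) * ∑ i, u i ^ 2)))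
    obtain ⟨hM0, hM1⟩ := max_lt_iff.1 hM
    rw [div_lt_iff₀ hd] at hM1
    obtain ⟨f, hf, hfge⟩ := hC M
    have hpos : 0 < ‖f‖ ^ 2 := by rw [hf]; positivity
    have hf0 : ‖f‖ ≠ 0 := by rintro h; simp [h] at hpos
    have hle := hs ⟨_, ⟨((‖f‖⁻¹ : ℝ) : ℂ) • f, by simp [norm_smul, hf0], rfl⟩, rfl⟩
    have hsc : ω * inner ℂ (((‖f‖⁻¹ : ℝ) : ℂ) • f) (tridiagOp ha hb hc (((‖f‖⁻¹ : ℝ) : ℂ) • f)) =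
        (((‖f‖ ^ 2)⁻¹ : ℝ) : ℂ) * (ω * inner ℂ f (tridiagOp ha hb hc f)) := by
      rw [map_smul, inner_smul_left, inner_smul_right, Complex.conj_ofReal]
      push_cast; ring
    rw [hsc, Complex.re_ofReal_mul, inv_mul_le_iff₀ hpos, hf] at hle
    nlinarith
  · change P n a b c l (-Real.cos θ) (-Real.sin θ) = 0
    rw [P_eq_det_cyclicMatrix_mul hn ha θ l rfl rfl, det_cyclicMatrix_eq_zero hu hul hl]
    simp
  · intro t ht
    by_contra! hlt
    have ht : P n a b c t (-Real.cos θ) (-Real.sin θ) = 0 := ht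
    rw [P_eq_det_cyclicMatrix_mul hn ha θ t rfl rfl, Complex.ofReal_eq_zero] at ht
    have h1 := det_cyclicMatrix_pos hlt hl
    have h2 : 0 ≤ ∏ j ∈ Finset.range (n + 1), ‖hopping ω a c j‖ :=
      Finset.prod_nonneg fun _ _ => norm_nonneg _
    exact (mul_pos h1 (by linarith)).ne' ht
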